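/- Let $k$ be an algebraically closed field and $n\ge 5$. Let $Q_1,\dots,Q_{n-2}\in\mathbb{P}^{n-3}_k$ be the coordinate points, $Q_{n-1}=[1:\cdots:1]$ and $Q_n=[p_1:\cdots:p_{n-2}]$, where $p\in k^{n-2}$ is such that $Q_1,\dots,Q_n$ are in linearly general position (any $n-2$ of the coordinate vectors are linearly independent). Let $X_n$ be the blow-up of $\mathbb{P}^{n-3}$ at $Q_1,\dots,Q_n$, and let $H,E_1,\dots,E_n$ be the basis of $\mathrm{Pic}(X_n)$ formed by the class of the pull-back of a hyperplane and the classes of the exceptional divisors. For $D=m_0H+\sum_i m_iE_i$ let $\Gamma(D)$ be the space of homogeneous polynomials of degree $m_0$ in $k[x_1,\dots,x_{n-2}]$ that vanish with multiplicity at least $-m_i$ at $Q_i$ for every $i$ (no condition at $Q_i$ if $m_i\ge 0$; and $\Gamma(D)=0$ if $m_0<0$). Equip $\mathrm{Pic}(X_n)$ with the symmetric bilinear form $H^2=n-4$, $E_iE_j=-\delta_{ij}$, $HE_i=0$. The $(-1)$-divisors are the elements of the orbit of $E_n$ under the group generated by the reflections $D\mapsto D+(D\cdot\alpha)\alpha$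 in the simple roots $\alpha=E_i-E_{i+1}$ $(1\le i\le n-1)$ and $\alpha=H-E_1-\cdots-E_{n-2}$. To a subset $B\subset[n]=\{1,\dots,n\}$ with $|B|=2s$ one attaches the $(-1)$-divisor $$D(B)=\begin{cases} s\,(H-\sum_{i=1}^nE_i)+\sum_{b\in B\cup\{n\}}E_b & \text{if } n\notin B,\\ (s-1)(H-\sum_{i=1}^nE_i)+\sum_{b\in B\setminus\{n\}}E_b & \text{if } n\in B.\end{cases}$$ Let $y\in k^{n-2}$ be a point that lies on none of the hypersurfaces defined by the $(-1)$-divisors, i.e. $f(y)\neq 0$ for every $(-1)$-divisor $D$ and every nonzero $f\in\Gamma(D)$. Let $M$ be the skew-symmetric $n\times n$ matrix over $k[x_1,\dots,x_{n-2}]$ whose entries above the diagonal are $$M_{ij}=\frac{(x_j-x_i)(y_j-y_i)}{p_j-p_i}\ (i<j\le n-2),\qquad M_{i,n-1}=-\frac{x_iy_i}{p_i}\ (i\le n-2),\qquad M_{in}=1\ (i\le n-1).$$ Then for every subset $B\subset[n]$ with an even number $|B|=2s$ of elements, the pfaffian $\mathrm{pfaff}(M_B)$ of the submatrix $M_B$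 with rows and columns indexed by $B$ is a nonzero element of $\Gamma(D(B))$. In particular it is homogeneous of degree $s$ if $n\notin B$ and $s-1$ if $n\in B$, and it vanishes to order at least $s-1$ at $Q_n$ (no condition if $s=0$). -/

import Mathlib

namespace BlowUp

open MvPolynomial

/-- The index `n` of the last element of `[n] = {1, …, n}`; here `[n]` is `Fin n`, so that
the index `i` of `[n]` has the value `i - 1` in `Fin n`. -/
def lastIdx (n : ℕ) [NeZero n] : Fin n := ⟨n - 1, Nat.sub_one_lt (NeZero.ne n)⟩

/-! ### Divisor classes on the blow-up of `ℙ^(n-3)` at `n` points -/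

/-- The Picard group `ℤ H ⊕ ℤ E₁ ⊕ ⋯ ⊕ ℤ Eₙ`: the pair `(m₀, m)` is `m₀ H + ∑ mᵢ Eᵢ`. -/
abbrev Pic (n : ℕ) : Type := ℤ × (Fin n → ℤ)

/-- The class of the pull-back of a hyperplane. -/
def H (n : ℕ) : Pic n := (1, 0)

/-- The class of the exceptional divisor over the `i`-th point. -/
def E {n : ℕ} (i : Fin n) : Pic n := (0, Pi.single i 1)

/-- The symmetric bilinear form with `H² = n - 4`, `Eᵢ Eⱼ = -δᵢⱼ`, `H Eᵢ = 0`. -/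
def form {n : ℕ} (D D' : Pic n) : ℤ := ((n : ℤ) - 4) * (D.1 * D'.1) - ∑ i, D.2 i * D'.2 i

/-- The simple roots `Eᵢ - Eᵢ₊₁` (`1 ≤ i ≤ n - 1`) and `H - E₁ - ⋯ - Eₙ₋₂` of the root system `Dₙ`
of classes of square `-2` orthogonal to the canonical class. -/
inductive IsSimpleRoot {n : ℕ} : Pic n → Prop
  | diff (i j : Fin n) (hij : j.val = i.val + 1) : IsSimpleRoot (E i - E j)
  | cremona : IsSimpleRoot (H n - ∑ i : Fin n with i.val + 2 < n, E i)

/-- The reflection in a class `α` with `α² = -2`. -/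
def reflect {n : ℕ} (α D : Pic n) : Pic n := D + form D α • α

/-- The `(-1)`-divisors: the orbit of `Eₙ` under the Weyl group, that is, under the group generated
by the (involutive) reflections in the simple roots. -/
inductive IsMinusOneDivisor {n : ℕ} [NeZero n] : Pic n → Prop
  | exceptional : IsMinusOneDivisor (E (lastIdx n))
  | reflect (α D : Pic n) (hα : IsSimpleRoot α) (hD : IsMinusOneDivisor D) :
      IsMinusOneDivisor (reflect α D)

/-- The divisor class `D(B)` attached to a subset `B` of `[n]` with `2 s` elements. -/
def divisorOf {n : ℕ} [NeZero n] (B : Finset (Fin n)) (s : ℕ) : Pic n :=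
  if lastIdx n ∈ B then
    ((s : ℤ) - 1) • (H n - ∑ i, E i) + ∑ b ∈ B.erase (lastIdx n), E b
  else
    (s : ℤ) • (H n - ∑ i, E i) + ∑ b ∈ insert (lastIdx n) B, E b

/-- The class with coefficients `d` and `-d + [i ∈ C]`; for `|C| = 2 d + 1` a `(-1)`-divisor. -/
def oddClass {n : ℕ} (C : Finset (Fin n)) (d : ℤ) : Pic n :=
  (d, fun i => -d + if i ∈ C then 1 else 0)

theorem sum_E {n : ℕ} (S : Finset (Fin n)) :
    ∑ b ∈ S, E b = ((0, fun i => if i ∈ S then 1 else 0) : Pic n) := by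
  ext i
  · simp [E, Prod.fst_sum]
  · simp [E, Prod.snd_sum, Finset.sum_apply, Pi.single_apply]

theorem divisorOf_eq {n : ℕ} [NeZero n] (B : Finset (Fin n)) (s : ℕ) :
    divisorOf B s = if lastIdx n ∈ B then oddClass (B.erase (lastIdx n)) ((s : ℤ) - 1)
      else oddClass (insert (lastIdx n) B) s := by
  unfold divisorOf
  split_ifs <;> rw [sum_E, sum_E] <;> ext i <;> simp [H, oddClass]

theorem isMinusOneDivisor_oddClass {n : ℕ} [NeZero n] (hn : 2 ≤ n) (N : ℕ) :
    ∀ (C : Finset (Fin n)) (d : ℕ), C.card = 2 * d + 1 → ∑ b ∈ C, (n - b.val) ≤ N →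
      IsMinusOneDivisor (oddClass C d) := by
  induction N with
  | zero =>
    intro C d hC hN
    obtain ⟨b, hb⟩ := Finset.card_pos.1 (by omega : 0 < C.card)
    have h1 := Finset.single_le_sum (f := fun b : Fin n => n - b.val) (fun _ _ => Nat.zero_le _) hb
    have := b.isLt
    omega
  | succ N ih =>
    intro C d hC hN
    by_cases hup : ∃ i j : Fin n, j.val = i.val + 1 ∧ i ∈ C ∧ j ∉ C
    · obtain ⟨i, j, hij, hi, hj⟩ := hup
      have hne : i ≠ j := by rintro rfl; exact hj hi
      have hj' : j ∉ C.erase i := fun h => hj (Finset.mem_of_mem_erase h)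
      have hcard : (insert j (C.erase i)).card = 2 * d + 1 := by
        rw [Finset.card_insert_of_notMem hj', Finset.card_erase_of_mem hi]; omega
      have hsum : ∑ b ∈ insert j (C.erase i), (n - b.val) ≤ N := by
        rw [Finset.sum_insert hj']
        have := Finset.add_sum_erase C (fun b : Fin n => n - b.val) hi
        have := j.isLt
        omega
      have h := IsMinusOneDivisor.reflect _ _ (.diff i j hij) (ih _ d hcard hsum)
      convert h using 1
      have hf : form (oddClass (insert j (C.erase i)) (d : ℤ)) (E i - E j) = 1 := by
        simp [form, oddClass, E, Pi.single_apply, mul_sub, Finset.sum_sub_distrib, hne]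
      rw [reflect, hf]
      ext l
      · simp [oddClass, E]
      · by_cases h1 : l = i
        · subst h1; simp [oddClass, E, hi, hne]
        · by_cases h2 : l = j
          · subst h2; simp [oddClass, E, hj, h1]
          · simp [oddClass, E, h1, h2]
    · push Not at hup
      have hlast : ∀ (m : ℕ) (b : Fin n), b ∈ C → ∀ c : Fin n, c.val = b.val + m → c ∈ C := by
        intro m
        induction m with
        | zero => intro b hb c hc; rwa [show c = b from Fin.ext (by omega)]
        | succ m ihm =>
          intro b hb c hc
          exact hup ⟨b.val + m, by omega⟩ c (by simp; omega) (ihm b hb _ rfl)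
      have hL : lastIdx n ∈ C := by
        obtain ⟨b, hb⟩ := Finset.card_pos.1 (by omega : 0 < C.card)
        have := b.isLt
        exact hlast (n - 1 - b.val) b hb _ (by simp [lastIdx]; omega)
      rcases Nat.eq_zero_or_pos d with rfl | hd
      · obtain ⟨b, rfl⟩ := Finset.card_eq_one.1 (by omega : C.card = 1)
        rw [Finset.mem_singleton] at hL
        subst hL
        convert IsMinusOneDivisor.exceptional (n := n) using 1
        ext l <;> simp [oddClass, E, Pi.single_apply]
      · set j : Fin n := lastIdx n with hjdef
        have hjv : j.val = n - 1 := rfl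
        set i : Fin n := ⟨n - 2, by omega⟩ with hidef
        have hiv : i.val = n - 2 := rfl
        have hne : i ≠ j := by intro h; have := congrArg Fin.val h; omega
        have hi : i ∈ C := by
          obtain ⟨b, hb⟩ := Finset.card_pos.1
            (by rw [Finset.card_erase_of_mem hL]; omega : 0 < (C.erase j).card)
          rw [Finset.mem_erase] at hb
          have h1 := b.isLt
          have h2 : b.val ≠ n - 1 := fun h => hb.1 (Fin.ext (by omega))
          exact hlast (n - 2 - b.val) b hb.2 _ (by omega)
        have hi' : i ∈ C.erase j := Finset.mem_erase.2 ⟨hne, hi⟩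
        have hcard : ((C.erase j).erase i).card = 2 * (d - 1) + 1 := by
          rw [Finset.card_erase_of_mem hi', Finset.card_erase_of_mem hL]; omega
        have hsum : ∑ b ∈ (C.erase j).erase i, (n - b.val) ≤ N := by
          have h1 := Finset.add_sum_erase C (fun b : Fin n => n - b.val) hL
          have h2 := Finset.add_sum_erase (C.erase j) (fun b : Fin n => n - b.val) hi'
          omega
        have h := IsMinusOneDivisor.reflect _ _ .cremona (ih _ (d - 1) hcard hsum)
        convert h using 1
        set C' := (C.erase j).erase i with hC'
        have hlt : ∀ l : Fin n, l.val + 2 < n ↔ l ≠ i ∧ l ≠ j := by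
          intro l
          rw [ne_eq, ne_eq, Fin.ext_iff, Fin.ext_iff]
          have := l.isLt
          omega
        have hF : (Finset.univ.filter fun l : Fin n => l.val + 2 < n).card = n - 2 := by
          have : (Finset.univ.filter fun l : Fin n => l.val + 2 < n)
              = (Finset.univ.erase j).erase i := by
            ext l; simp [hlt]
          rw [this, Finset.card_erase_of_mem (by simp [hne]), Finset.card_erase_of_mem (by simp)]
          simp; omega
        have hCF : (Finset.univ.filter fun l : Fin n => l.val + 2 < n).filter (· ∈ C') = C' := by
          ext l
          simp [hlt, hC']
          tauto
        have hf : form (oddClass C' ((d - 1 : ℕ) : ℤ))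
            (H n - ∑ l : Fin n with l.val + 2 < n, E l) = 1 := by
          have hs : ∑ l : Fin n, (oddClass C' ((d - 1 : ℕ) : ℤ)).2 l *
              (H n - ∑ l : Fin n with l.val + 2 < n, E l).2 l
              = - ∑ l : Fin n with l.val + 2 < n, (-((d - 1 : ℕ) : ℤ) + if l ∈ C' then 1 else 0) := by
            rw [sum_E, Finset.sum_filter, ← Finset.sum_neg_distrib]
            refine Finset.sum_congr rfl fun l _ => ?_
            by_cases h : l.val + 2 < n <;> simp [oddClass, H, h]
          rw [form, hs, Finset.sum_add_distrib, Finset.sum_const, hF, ← Finset.sum_filter, hCF,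
            Finset.sum_const, hcard, sum_E]
          simp [oddClass, H]
          push_cast [Nat.cast_sub hn, Nat.cast_sub hd]
          ring
        rw [reflect, hf, sum_E]
        ext l
        · simp [oddClass, H]; omega
        · by_cases h1 : l = i
          · simp [oddClass, H, h1, hC', hi, hlt]; omega
          · by_cases h2 : l = j
            · simp [oddClass, H, h2, hC', hL, hlt]; omega
            · have : l.val + 2 < n := by rw [hlt]; tauto
              simp [oddClass, H, this, h1, h2, hC']; omega

/-- `D(B)` is a `(-1)`-divisor. -/
theorem isMinusOneDivisor_divisorOf {n : ℕ} [NeZero n] (hn : 2 ≤ n) (B : Finset (Fin n)) (s : ℕ)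
    (hB : B.card = 2 * s) : IsMinusOneDivisor (divisorOf B s) := by
  rw [divisorOf_eq]
  split_ifs with h
  · have hpos := Finset.card_pos.2 ⟨_, h⟩
    have := isMinusOneDivisor_oddClass hn _ (B.erase (lastIdx n)) (s - 1)
      (by rw [Finset.card_erase_of_mem h]; omega) le_rfl
    rwa [Nat.cast_sub (by omega), Nat.cast_one] at this
  · exact isMinusOneDivisor_oddClass hn _ _ s
      (by rw [Finset.card_insert_of_notMem h, hB]) le_rfl

/-! ### The points and the sections -/

/-- The points `Q₁, …, Qₙ` in homogeneous coordinates: the `n - 2` canonical basis vectors,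
`(1 : ⋯ : 1)` and `(p₁ : ⋯ : pₙ₋₂)`. -/
def point {k : Type*} [Field k] {n : ℕ} (p : Fin (n - 2) → k) (i : Fin n) : Fin (n - 2) → k :=
  if h : i.val < n - 2 then Pi.single ⟨i.val, h⟩ 1
  else if i.val = n - 2 then 1
  else p

/-- The points `q i` of `ℙ^(r-1)`, given by homogeneous coordinates, are in linearly general
position: any `r` of them are linearly independent. -/
def LinearlyGeneral {k : Type*} [Field k] {n r : ℕ} (q : Fin n → Fin r → k) : Prop :=
  ∀ S : Finset (Fin n), S.card = r → LinearIndependent k (fun i : S => q i)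

/-- The ideal of the polynomials that vanish at `q`. A (homogeneous) polynomial vanishes with
multiplicity at least `m` at `q` if it lies in the `m`-th power of this ideal. -/
noncomputable def pointIdeal {k : Type*} [Field k] {r : ℕ} (q : Fin r → k) : Ideal (MvPolynomial (Fin r) k) :=
  Ideal.span (Set.range fun i => X i - C (q i))

/-- The space `Γ(D)` of sections of `D = m₀ H + ∑ mᵢ Eᵢ`: the homogeneous polynomials of degree
`m₀` in `x₁, …, xₙ₋₂` that vanish with multiplicity at least `-mᵢ` at `Qᵢ` for every `i`
(no condition where `mᵢ ≥ 0`; only the zero polynomial if `m₀ < 0`). -/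
noncomputable def sections {k : Type*} [Field k] {n : ℕ} (p : Fin (n - 2) → k) (D : Pic n) :
    Submodule k (MvPolynomial (Fin (n - 2)) k) :=
  (if 0 ≤ D.1 then homogeneousSubmodule (Fin (n - 2)) k D.1.toNat else ⊥) ⊓
    ⨅ i, (pointIdeal (point p i) ^ (-D.2 i).toNat).restrictScalars k

/-! ### The skew-symmetric matrix and its pfaffians -/

/-- A vector `(v₁, …, vₙ₋₂)`, continued by zero to the indices `n - 1` and `n`. -/
def extend {R : Type*} [Zero R] {n : ℕ} (v : Fin (n - 2) → R) (i : Fin n) : R :=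
  if h : i.val < n - 2 then v ⟨i.val, h⟩ else 0

/-- The skew-symmetric `n × n` matrix `M` with entries
`(xⱼ - xᵢ) (yⱼ - yᵢ) / (pⱼ - pᵢ)` for `i, j < n` and `1` for `i < j = n`, where
`xₙ₋₁ = yₙ₋₁ = pₙ₋₁ = 0`; so the entry is `- xᵢ yᵢ / pᵢ` for `i < j = n - 1`. -/
noncomputable def skewMatrix {k : Type*} [Field k] {n : ℕ} [NeZero n] (p y : Fin (n - 2) → k) :
    Matrix (Fin n) (Fin n) (MvPolynomial (Fin (n - 2)) k) :=
  Matrix.of fun i j =>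
    if i = j then 0
    else if j = lastIdx n then 1
    else if i = lastIdx n then -1
    else C ((extend y j - extend y i) / (extend p j - extend p i)) * (extend X j - extend X i)

/-- The first element of the `r`-th pair in `{0, 1}, {2, 3}, …`. -/
def pairFst {s : ℕ} (r : Fin s) : Fin (2 * s) := ⟨2 * r.val, by omega⟩

/-- The second element of the `r`-th pair in `{0, 1}, {2, 3}, …`. -/
def pairSnd {s : ℕ} (r : Fin s) : Fin (2 * s) := ⟨2 * r.val + 1, by omega⟩

/-- The pfaffian of a skew-symmetric matrix of size `2 s`: the signed sum over all perfect matchings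
`{a₁ < b₁}, …, {aₛ < bₛ}`, `a₁ < ⋯ < aₛ`, of the products of the entries at `(aᵣ, bᵣ)`. A matching
is the permutation `σ` with values `a₁, b₁, …, aₛ, bₛ`. -/
def pfaffian {R : Type*} [CommRing R] {s : ℕ} (A : Matrix (Fin (2 * s)) (Fin (2 * s)) R) : R :=
  ∑ σ : Equiv.Perm (Fin (2 * s)) with
      (∀ r, σ (pairFst r) < σ (pairSnd r)) ∧ (∀ r t, r < t → σ (pairFst r) < σ (pairFst t)),
    ((Equiv.Perm.sign σ : ℤ) : R) * ∏ r, A (σ (pairFst r)) (σ (pairSnd r))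

/-- The submatrix `A_B` with rows and columns indexed by `B`, in increasing order. -/
def subMatrix {R : Type*} {n s : ℕ} (A : Matrix (Fin n) (Fin n) R) (B : Finset (Fin n))
    (hB : B.card = 2 * s) : Matrix (Fin (2 * s)) (Fin (2 * s)) R :=
  A.submatrix (B.orderEmbOfFin hB) (B.orderEmbOfFin hB)

end BlowUp

/-! Write f_y(x) for the pfaffian of M_B. Each entry of M off the last row and column is a product
of a factor in x and a factor in y over p_j - p_i, so f_y(x) = f_x(y) (`eval_pfaffian_comm`). For
every y, without any genericity, f_y lies in Γ(D(B)) (`pfaffian_subMatrix_mem_sections`). Hence it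
suffices to find one x with f_x(x) ≠ 0: then f_x is a nonzero section of the (-1)-divisor D(B), so
f_x(y) ≠ 0 by the choice of y, and f_y(x) = f_x(y) shows f_y ≠ 0.

Multiplicities: at Q_i with i < n all entries outside the rows and columns i and n vanish, so each
matching has at least s - |B ∩ {i, n}| vanishing factors. At Q_n the matrix becomes an alternating
matrix of rank two. Adding t times such a matrix to N gives a pfaffian of degree at most one in t
(`natDegree_pfaffian_pencil_le`), so at least s - 1 factors of the vanishing part survive in every
term (`pfaffian_mem_pow_of_rank_two`).

Nonvanishing: take x = y to be the indicator of the first half of B. The block of the first half is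
then zero, the pfaffian is up to sign the determinant of the off-diagonal block
(`pfaffian_eq_det_of_zero_block`), and this is a Cauchy matrix in the p_i, with a column of ones if
n ∈ B (`det_cauchy_ne_zero`). -/

namespace BlowUp

open Equiv

/-! ### Pfaffians -/

/-- The decomposition of `{0, …, 2 s - 1}` into the pairs `{0, 1}, {2, 3}, …`. -/
def pairEquiv (s : ℕ) : Fin s × Bool ≃ Fin (2 * s) where
  toFun x := if x.2 then pairSnd x.1 else pairFst x.1
  invFun i := (⟨i.val / 2, by omega⟩, decide (i.val % 2 = 1))
  left_inv := by
    rintro ⟨r, b⟩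
    cases b <;> ext <;> simp [pairFst, pairSnd]
    omega
  right_inv := by
    intro i
    ext
    by_cases h : i.val % 2 = 1 <;> simp [pairFst, pairSnd, h] <;> omega

@[simp] theorem pairEquiv_false {s : ℕ} (r : Fin s) : pairEquiv s (r, false) = pairFst r := rfl

@[simp] theorem pairEquiv_true {s : ℕ} (r : Fin s) : pairEquiv s (r, true) = pairSnd r := rfl

theorem pairFst_injective {s : ℕ} : Function.Injective (pairFst (s := s)) := fun a b h => by
  have := congrArg Fin.val h
  simp only [pairFst] at this
  exact Fin.ext (by omega)

theorem pairSnd_injective {s : ℕ} : Function.Injective (pairSnd (s := s)) := fun a b h => by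
  have := congrArg Fin.val h
  simp only [pairSnd] at this
  exact Fin.ext (by omega)

theorem pairFst_ne_pairSnd {s : ℕ} (a b : Fin s) : pairFst a ≠ pairSnd b := fun h => by
  have := congrArg Fin.val h
  simp only [pairFst, pairSnd] at this
  omega

/-- The condition on a permutation to be the standard representative of a perfect matching. -/
def IsMatching {s : ℕ} (σ : Perm (Fin (2 * s))) : Prop :=
  (∀ r, σ (pairFst r) < σ (pairSnd r)) ∧ (∀ r t, r < t → σ (pairFst r) < σ (pairFst t))

instance {s : ℕ} : DecidablePred (IsMatching (s := s)) := fun σ => by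
  unfold IsMatching; infer_instance

theorem pfaffian_def {R : Type*} [CommRing R] {s : ℕ} (A : Matrix (Fin (2 * s)) (Fin (2 * s)) R) :
    pfaffian A = ∑ σ : Perm (Fin (2 * s)) with IsMatching σ,
      ((Perm.sign σ : ℤ) : R) * ∏ r, A (σ (pairFst r)) (σ (pairSnd r)) := by
  unfold pfaffian
  congr!

theorem map_pfaffian {R S : Type*} [CommRing R] [CommRing S] (φ : R →+* S) {s : ℕ}
    (A : Matrix (Fin (2 * s)) (Fin (2 * s)) R) : φ (pfaffian A) = pfaffian (A.map φ) := by
  simp [pfaffian, map_sum, map_prod]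

theorem pfaffian_congr {R : Type*} [CommRing R] {s : ℕ}
    {A B : Matrix (Fin (2 * s)) (Fin (2 * s)) R} (h : ∀ i j, i < j → A i j = B i j) :
    pfaffian A = pfaffian B := by
  rw [pfaffian_def, pfaffian_def]
  refine Finset.sum_congr rfl fun σ hσ => ?_
  rw [Finset.mem_filter] at hσ
  rw [Finset.prod_congr rfl fun r _ => h _ _ (hσ.2.1 r)]

/-- The permutation of `Fin (2 * s)` that flips the pairs according to `ε` and
permutes them by `π`. -/
def pairPerm {s : ℕ} (π : Perm (Fin s)) (ε : Fin s → Perm Bool) : Perm (Fin (2 * s)) :=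
  (pairEquiv s).permCongr ((Equiv.prodCongrLeft fun _ : Bool => π) * Equiv.prodCongrRight ε)

theorem pairPerm_apply {s : ℕ} (π : Perm (Fin s)) (ε : Fin s → Perm Bool) (r : Fin s) (b : Bool) :
    pairPerm π ε (pairEquiv s (r, b)) = pairEquiv s (π r, ε r b) := by
  simp [pairPerm, Equiv.permCongr_apply]

theorem sign_pairPerm {s : ℕ} (π : Perm (Fin s)) (ε : Fin s → Perm Bool) :
    Perm.sign (pairPerm π ε) = ∏ r, Perm.sign (ε r) := by
  rw [pairPerm, Perm.sign_permCongr, Perm.sign_mul, Perm.sign_prodCongrLeft,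
    Perm.sign_prodCongrRight]
  simp

theorem perm_bool (η : Perm Bool) : η = 1 ∨ η = swap false true := by
  revert η; decide

theorem skew_perm_bool {R ι : Type*} [CommRing R] {A : Matrix ι ι R} (hA : ∀ i j, A j i = -A i j)
    (x : Bool → ι) (η : Perm Bool) :
    ((Perm.sign η : ℤ) : R) * A (x (η false)) (x (η true)) = A (x false) (x true) := by
  rcases perm_bool η with rfl | rfl
  · simp
  · rw [Perm.sign_swap (by decide)]
    simp [hA (x false) (x true)]

/-- Flipping a pair changes the sign of the permutation and that of one entry. Permuting whole pairs
is even, since it acts alike on first and second elements, and only reorders the factors. -/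
theorem sign_mul_prod_pairPerm {R : Type*} [CommRing R] {s : ℕ}
    {A : Matrix (Fin (2 * s)) (Fin (2 * s)) R} (hA : ∀ i j, A j i = -A i j)
    (σ : Perm (Fin (2 * s))) (π : Perm (Fin s)) (ε : Fin s → Perm Bool) :
    ((Perm.sign (σ * pairPerm π ε) : ℤ) : R) *
        ∏ r, A ((σ * pairPerm π ε) (pairFst r)) ((σ * pairPerm π ε) (pairSnd r)) =
      ((Perm.sign σ : ℤ) : R) * ∏ r, A (σ (pairFst r)) (σ (pairSnd r)) := by
  have h (r : Fin s) : ((Perm.sign (ε r) : ℤ) : R) *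
      A ((σ * pairPerm π ε) (pairFst r)) ((σ * pairPerm π ε) (pairSnd r)) =
        A (σ (pairFst (π r))) (σ (pairSnd (π r))) := by
    have := skew_perm_bool hA (fun b => σ (pairEquiv s (π r, b))) (ε r)
    rw [← pairEquiv_false r, ← pairEquiv_true r, Perm.mul_apply, Perm.mul_apply, pairPerm_apply,
      pairPerm_apply]
    exact this
  rw [Perm.sign_mul, sign_pairPerm, Units.val_mul, Int.cast_mul, Units.coe_prod, Int.cast_prod,
    mul_assoc, ← Finset.prod_mul_distrib, Finset.prod_congr rfl fun r _ => h r]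
  rw [Equiv.prod_comp π fun r => A (σ (pairFst r)) (σ (pairSnd r))]

/-- Here g is a monotone rearrangement of the monotone f, and such a rearrangement is f itself;
injectivity of f does the rest. -/
theorem eq_of_strictMono_of_comp_perm {α : Type*} [PartialOrder α] {s : ℕ} {f g : Fin s → α}
    (hf : StrictMono f) (hg : StrictMono g) {π π' : Perm (Fin s)} (h : f ∘ π = g ∘ π') : π = π' := by
  have h1 : f ∘ (π * π'⁻¹) = g := by
    ext r
    simpa using congrFun h (π'⁻¹ r)
  have h2 : f ∘ (π * π'⁻¹) = f ∘ (1 : Perm (Fin s)) :=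
    Tuple.unique_monotone (by rw [h1]; exact hg.monotone) (by simpa using hf.monotone)
  have h3 : π * π'⁻¹ = 1 := by
    ext r
    rw [hf.injective (congrFun h2 r)]
  exact mul_inv_eq_one.1 h3

/-- The order inside each pair determines the flips; then the increasing order of the first elements
determines the permutation of the pairs. -/
theorem matching_mul_pairPerm_injective {s : ℕ} {ρ ρ' : Perm (Fin (2 * s))} (hρ : IsMatching ρ)
    (hρ' : IsMatching ρ') {π π' : Perm (Fin s)} {ε ε' : Fin s → Perm Bool}
    (h : ρ * pairPerm π ε = ρ' * pairPerm π' ε') : ρ = ρ' ∧ π = π' ∧ ε = ε' := by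
  have key (r : Fin s) (b : Bool) :
      ρ (pairEquiv s (π r, ε r b)) = ρ' (pairEquiv s (π' r, ε' r b)) := by
    have := congrArg (fun τ : Perm (Fin (2 * s)) => τ (pairEquiv s (r, b))) h
    simpa only [Perm.mul_apply, pairPerm_apply] using this
  have hε : ε = ε' := by
    funext r
    have h0 := key r false
    have h1 := key r true
    have ho := hρ.1 (π r)
    have ho' := hρ'.1 (π' r)
    rcases perm_bool (ε r) with e | e <;> rcases perm_bool (ε' r) with e' | e' <;>
      rw [e, e'] at h0 h1 ⊢ <;> simp at h0 h1
    · rw [h0, h1] at ho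
      exact absurd ho ho'.asymm
    · rw [h0, h1] at ho
      exact absurd ho ho'.asymm
  subst hε
  have hπ : π = π' := by
    refine eq_of_strictMono_of_comp_perm (f := ρ ∘ pairFst) (g := ρ' ∘ pairFst)
      (fun r t => hρ.2 r t) (fun r t => hρ'.2 r t) ?_
    funext r
    simpa using key r ((ε r).symm false)
  subst hπ
  exact ⟨mul_right_cancel h, rfl, rfl⟩

/-- Flip every pair into increasing order, then sort the pairs by their smaller elements. -/
theorem exists_matching_mul_pairPerm {s : ℕ} (σ : Perm (Fin (2 * s))) :
    ∃ ρ π ε, IsMatching ρ ∧ ρ * pairPerm (s := s) π ε = σ := by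
  let η : Fin s → Perm Bool := fun r =>
    if σ (pairFst r) < σ (pairSnd r) then 1 else swap false true
  let f : Fin s → Fin (2 * s) := fun r => σ (pairEquiv s (r, η r false))
  have hη (r : Fin s) : f r < σ (pairEquiv s (r, η r true)) := by
    by_cases h : σ (pairFst r) < σ (pairSnd r)
    · simp [f, η, h]
    · have : σ (pairSnd r) ≠ σ (pairFst r) := fun h => pairFst_ne_pairSnd r r (σ.injective h).symm
      simpa [f, η, h] using lt_of_le_of_ne (not_lt.1 h) this
  have hf : Function.Injective f := fun r t h => by
    have := (pairEquiv s).injective (σ.injective h)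
    exact (Prod.ext_iff.1 this).1
  have hs : StrictMono (f ∘ Tuple.sort f) :=
    (Tuple.monotone_sort f).strictMono_of_injective (hf.comp (Tuple.sort f).injective)
  let θ := pairPerm (Tuple.sort f) (fun r => η (Tuple.sort f r))
  have hθ (r : Fin s) (b : Bool) :
      (σ * θ) (pairEquiv s (r, b)) = σ (pairEquiv s (Tuple.sort f r, η (Tuple.sort f r) b)) := by
    rw [Perm.mul_apply, pairPerm_apply]
  refine ⟨σ * θ, (Tuple.sort f)⁻¹, fun r => (η r)⁻¹, ⟨fun r => ?_, fun r t hrt => ?_⟩, ?_⟩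
  · rw [← pairEquiv_false, ← pairEquiv_true, hθ, hθ]
    exact hη _
  · rw [← pairEquiv_false, ← pairEquiv_false, hθ, hθ]
    exact hs hrt
  · ext i
    obtain ⟨⟨r, b⟩, rfl⟩ := (pairEquiv s).surjective i
    rw [Perm.mul_apply, pairPerm_apply, hθ]
    simp

/-- Every matching is represented by 2^s s! permutations, all with the same term. The full sum is
easier to handle, since transpositions act on it. -/
theorem card_mul_pfaffian {R : Type*} [CommRing R] {s : ℕ}
    {A : Matrix (Fin (2 * s)) (Fin (2 * s)) R} (hA : ∀ i j, A j i = -A i j) :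
    (Fintype.card (Perm (Fin s) × (Fin s → Perm Bool)) : R) * pfaffian A =
      ∑ σ : Perm (Fin (2 * s)),
        ((Perm.sign σ : ℤ) : R) * ∏ r, A (σ (pairFst r)) (σ (pairSnd r)) := by
  have h : ∑ x ∈ (Finset.univ.filter fun σ : Perm (Fin (2 * s)) => IsMatching σ) ×ˢ
      (Finset.univ : Finset (Perm (Fin s) × (Fin s → Perm Bool))),
      ((Perm.sign x.1 : ℤ) : R) * ∏ r, A (x.1 (pairFst r)) (x.1 (pairSnd r)) =
      ∑ σ : Perm (Fin (2 * s)),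
        ((Perm.sign σ : ℤ) : R) * ∏ r, A (σ (pairFst r)) (σ (pairSnd r)) := by
    refine Finset.sum_bij (fun x _ => x.1 * pairPerm x.2.1 x.2.2) (fun _ _ => Finset.mem_univ _)
      ?_ ?_ ?_
    · rintro ⟨ρ, π, ε⟩ h ⟨ρ', π', ε'⟩ h' e
      simp only [Finset.mem_product, Finset.mem_filter, Finset.mem_univ, true_and, and_true] at h h'
      obtain ⟨rfl, rfl, rfl⟩ := matching_mul_pairPerm_injective h h' e
      rfl
    · intro σ _
      obtain ⟨ρ, π, ε, h, e⟩ := exists_matching_mul_pairPerm σ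
      exact ⟨(ρ, π, ε), by simpa using h, e⟩
    · rintro ⟨ρ, π, ε⟩ _
      exact (sign_mul_prod_pairPerm hA ρ π ε).symm
  rw [← h, Finset.sum_product, pfaffian_def, Finset.mul_sum]
  simp

/-! ### Adding a matrix of rank two -/

/-- Terms are cancelled in pairs σ, σ (i j), so the argument also works in characteristic two. -/
theorem sum_sign_mul_eq_zero {R α : Type*} [CommRing R] [Fintype α] [DecidableEq α]
    (g : Perm α → R) {i j : α} (hij : i ≠ j) (hg : ∀ σ, g (σ * swap i j) = g σ) :
    ∑ σ : Perm α, ((Perm.sign σ : ℤ) : R) * g σ = 0 := by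
  refine Finset.sum_involution (fun σ _ => σ * swap i j) ?_ ?_ (fun _ _ => Finset.mem_univ _) ?_
  · intro σ _
    simp [hg, Perm.sign_mul, Perm.sign_swap hij]
  · intro σ _ _ h
    exact hij (swap_eq_one_iff.1 (mul_eq_left.1 h))
  · intro σ _
    simp [mul_assoc]

/-- Expanding the two rank-two factors gives four products. In each of them u occurs at one position
of the pair r and one of the pair t; transposing these positions fixes the product, so its signed
sum vanishes. -/
theorem sum_sign_mul_two_pairs {R : Type*} [CommRing R] {s : ℕ} (u v : Fin (2 * s) → R)
    {r t : Fin s} (hrt : r ≠ t) (g : Fin s → Fin (2 * s) → Fin (2 * s) → R) (S : Finset (Fin s))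
    (hr : r ∉ S) (ht : t ∉ S) :
    ∑ σ : Perm (Fin (2 * s)), ((Perm.sign σ : ℤ) : R) *
      ((u (σ (pairFst r)) * v (σ (pairSnd r)) - v (σ (pairFst r)) * u (σ (pairSnd r))) *
        (u (σ (pairFst t)) * v (σ (pairSnd t)) - v (σ (pairFst t)) * u (σ (pairSnd t))) *
        ∏ q ∈ S, g q (σ (pairFst q)) (σ (pairSnd q))) = 0 := by
  have hG (i j : Fin (2 * s)) (hi : i = pairFst r ∨ i = pairSnd r) (hj : j = pairFst t ∨ j = pairSnd t)
      (σ : Perm (Fin (2 * s))) :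
      ∏ q ∈ S, g q ((σ * swap i j) (pairFst q)) ((σ * swap i j) (pairSnd q)) =
        ∏ q ∈ S, g q (σ (pairFst q)) (σ (pairSnd q)) := by
    refine Finset.prod_congr rfl fun q hq => ?_
    have h1 : q ≠ r := by rintro rfl; exact hr hq
    have h2 : q ≠ t := by rintro rfl; exact ht hq
    rw [Perm.mul_apply, Perm.mul_apply, swap_apply_of_ne_of_ne, swap_apply_of_ne_of_ne]
    · rcases hi with rfl | rfl
      · exact (pairFst_ne_pairSnd _ _).symm
      · exact fun h => h1 (pairSnd_injective h)
    · rcases hj with rfl | rfl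
      · exact (pairFst_ne_pairSnd _ _).symm
      · exact fun h => h2 (pairSnd_injective h)
    · rcases hi with rfl | rfl
      · exact fun h => h1 (pairFst_injective h)
      · exact pairFst_ne_pairSnd _ _
    · rcases hj with rfl | rfl
      · exact fun h => h2 (pairFst_injective h)
      · exact pairFst_ne_pairSnd _ _
  have hne (i j : Fin (2 * s)) (hi : i = pairFst r ∨ i = pairSnd r)
      (hj : j = pairFst t ∨ j = pairSnd t) : i ≠ j := by
    rcases hi with rfl | rfl <;> rcases hj with rfl | rfl
    · exact fun h => hrt (pairFst_injective h)
    · exact pairFst_ne_pairSnd _ _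
    · exact (pairFst_ne_pairSnd _ _).symm
    · exact fun h => hrt (pairSnd_injective h)
  have key (i i' j j' : Fin (2 * s)) (hi : i = pairFst r ∨ i = pairSnd r)
      (hi' : i' = pairFst r ∨ i' = pairSnd r) (hj : j = pairFst t ∨ j = pairSnd t)
      (hj' : j' = pairFst t ∨ j' = pairSnd t) (hii : i' ≠ i) (hjj : j' ≠ j) :
      ∑ σ : Perm (Fin (2 * s)), ((Perm.sign σ : ℤ) : R) *
        ((u (σ i) * v (σ i') * (u (σ j) * v (σ j'))) *
          ∏ q ∈ S, g q (σ (pairFst q)) (σ (pairSnd q))) = 0 := by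
    refine sum_sign_mul_eq_zero _ (hne i j hi hj) fun σ => ?_
    rw [hG i j hi hj]
    simp only [Perm.mul_apply, swap_apply_left, swap_apply_right]
    rw [swap_apply_of_ne_of_ne hii (hne i' j hi' hj),
      swap_apply_of_ne_of_ne (hne i j' hi hj').symm hjj]
    ring
  have hr' := pairFst_ne_pairSnd r r
  have ht' := pairFst_ne_pairSnd t t
  have k1 := key _ _ _ _ (.inl rfl) (.inr rfl) (.inl rfl) (.inr rfl) hr'.symm ht'.symm
  have k2 := key _ _ _ _ (.inl rfl) (.inr rfl) (.inr rfl) (.inl rfl) hr'.symm ht'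
  have k3 := key _ _ _ _ (.inr rfl) (.inl rfl) (.inl rfl) (.inr rfl) hr' ht'.symm
  have k4 := key _ _ _ _ (.inr rfl) (.inl rfl) (.inr rfl) (.inl rfl) hr' ht'
  have := congrArg₂ (· - ·) (congrArg₂ (· + ·) k1 k4) (congrArg₂ (· + ·) k2 k3)
  simp only [← Finset.sum_add_distrib, ← Finset.sum_sub_distrib, add_zero, sub_zero] at this
  rw [← this]
  refine Finset.sum_congr rfl fun σ _ => ?_
  ring

open Polynomial in
/-- The pencil spanned by a matrix and the alternating matrix of rank two given by two vectors. -/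
noncomputable def pencil {R ι : Type*} [CommRing R] (N : Matrix ι ι R) (u v : ι → R) :
    Matrix ι ι R[X] :=
  Matrix.of fun i j => C (N i j) + X * C (u i * v j - v i * u j)

-- Expand by the set T of pairs that contribute the rank-two part: |T| ≤ 1 gives degree at most one,
-- and |T| ≥ 2 cancels in the sum over all permutations.
open Polynomial in
theorem natDegree_sum_sign_mul_prod_pencil_le {R : Type*} [CommRing R] {s : ℕ}
    (N : Matrix (Fin (2 * s)) (Fin (2 * s)) R) (u v : Fin (2 * s) → R) :
    (∑ σ : Perm (Fin (2 * s)), ((Perm.sign σ : ℤ) : R[X]) *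
      ∏ r, pencil N u v (σ (pairFst r)) (σ (pairSnd r))).natDegree ≤ 1 := by
  have h (σ : Perm (Fin (2 * s))) := Finset.prod_add
    (fun r => X * C (u (σ (pairFst r)) * v (σ (pairSnd r)) - v (σ (pairFst r)) * u (σ (pairSnd r))))
    (fun r => C (N (σ (pairFst r)) (σ (pairSnd r)))) Finset.univ
  simp only [pencil, Matrix.of_apply, add_comm (C (N _ _)), h, Finset.mul_sum]
  rw [Finset.sum_comm]
  refine natDegree_sum_le_of_forall_le _ _ fun T _ => ?_
  by_cases hT : T.card ≤ 1
  · refine natDegree_sum_le_of_forall_le _ _ fun σ _ => ?_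
    rw [Finset.prod_mul_distrib, Finset.prod_const, ← map_prod, ← map_prod, ← C_eq_intCast,
      mul_assoc, ← C_mul, mul_comm, mul_assoc, ← C_mul]
    exact (natDegree_mul_C_le _ _).trans ((natDegree_X_pow_le _).trans hT)
  · obtain ⟨r, hr, t, ht, hrt⟩ := Finset.one_lt_card.1 (not_le.1 hT)
    have h0 := sum_sign_mul_two_pairs (fun i => C (u i)) (fun i => C (v i)) hrt
      (fun q i j => if q ∈ T then X * C (u i * v j - v i * u j) else C (N i j))
      ((Finset.univ.erase r).erase t) (by simp) (by simp)
    have h1 : ∑ σ : Perm (Fin (2 * s)), ((Perm.sign σ : ℤ) : R[X]) *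
        ((∏ q ∈ T, X * C (u (σ (pairFst q)) * v (σ (pairSnd q)) -
            v (σ (pairFst q)) * u (σ (pairSnd q)))) *
          ∏ q ∈ Finset.univ \ T, C (N (σ (pairFst q)) (σ (pairSnd q)))) = 0 := by
      -- The factor X ^ 2 restores the variables of the pairs r and t, whose factors in `h0` carry
      -- none.
      have h2 := congrArg (fun P => X ^ 2 * P) h0
      simp only [mul_zero, Finset.mul_sum] at h2
      rw [← h2]
      refine Finset.sum_congr rfl fun σ _ => ?_
      have h3 := Finset.prod_ite (s := Finset.univ) (p := (· ∈ T))
        (fun q => X * C (u (σ (pairFst q)) * v (σ (pairSnd q)) -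
            v (σ (pairFst q)) * u (σ (pairSnd q))))
        (fun q => C (N (σ (pairFst q)) (σ (pairSnd q))))
      rw [Finset.filter_mem_eq_inter, Finset.univ_inter, Finset.filter_notMem_eq_sdiff] at h3
      rw [← h3, ← Finset.mul_prod_erase _ _ (Finset.mem_univ r),
        ← Finset.mul_prod_erase (Finset.univ.erase r) _ (Finset.mem_erase.2 ⟨hrt.symm, Finset.mem_univ t⟩)]
      simp only [hr, ht, if_true, map_sub, map_mul]
      ring
    rw [h1]
    simp

-- In characteristic zero the factor 2^s s! between the full sum and the pfaffian does not affect
-- the degree.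
open Polynomial in
theorem natDegree_pfaffian_pencil_le_of_charZero {R : Type*} [CommRing R] [IsDomain R] [CharZero R]
    {s : ℕ} {N : Matrix (Fin (2 * s)) (Fin (2 * s)) R} (hN : ∀ i j, N j i = -N i j)
    (u v : Fin (2 * s) → R) : (pfaffian (pencil N u v)).natDegree ≤ 1 := by
  have h := natDegree_sum_sign_mul_prod_pencil_le N u v
  rw [← card_mul_pfaffian (A := pencil N u v), ← C_eq_natCast, natDegree_C_mul] at h
  · exact h
  · exact Nat.cast_ne_zero.2 Fintype.card_ne_zero
  · intro i j
    simp only [pencil, Matrix.of_apply, hN i j]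
    simp only [map_sub, map_mul, map_neg]
    ring

/-- Specialization of the generic case over a polynomial ring over ℤ, where characteristic zero is
available. -/
theorem natDegree_pfaffian_pencil_le {R : Type*} [CommRing R] {s : ℕ}
    (N : Matrix (Fin (2 * s)) (Fin (2 * s)) R) (u v : Fin (2 * s) → R) :
    (pfaffian (pencil N u v)).natDegree ≤ 1 := by
  let ι := Fin (2 * s)
  let P := MvPolynomial ((ι × ι) ⊕ ι ⊕ ι) ℤ
  let φ : P →+* R := MvPolynomial.eval₂Hom (Int.castRingHom R)
    -- Variables on or below the diagonal go to 0, so that `N'` specializes to N above the diagonal,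
    -- the only part that the pfaffian sees.
    (Sum.elim (fun x => if x.1 < x.2 then N x.1 x.2 else 0) (Sum.elim u v))
  let N' : Matrix ι ι P := Matrix.of fun i j =>
    MvPolynomial.X (.inl (i, j)) - MvPolynomial.X (.inl (j, i))
  let u' : ι → P := fun i => MvPolynomial.X (.inr (.inl i))
  let v' : ι → P := fun i => MvPolynomial.X (.inr (.inr i))
  have h := natDegree_pfaffian_pencil_le_of_charZero (N := N')
    (fun i j => by simp [N']) u' v'
  have hφ (x) : φ (MvPolynomial.X x) =
      Sum.elim (fun x : ι × ι => if x.1 < x.2 then N x.1 x.2 else 0) (Sum.elim u v) x :=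
    MvPolynomial.eval₂Hom_X' _ _ x
  have h1 : pfaffian (pencil N u v) = (pfaffian (pencil N' u' v')).map φ := by
    have := map_pfaffian (Polynomial.mapRingHom φ) (pencil N' u' v')
    rw [Polynomial.coe_mapRingHom] at this
    rw [this]
    refine pfaffian_congr fun i j hij => ?_
    simp [pencil, N', u', v', hφ, hij, hij.asymm]
  rw [h1]
  exact (Polynomial.natDegree_map_le).trans h

-- A term of degree m takes X from m factors and an element of I from the others.
open Polynomial in
theorem coeff_prod_C_add_X_mul_C_mem {R ι : Type*} [CommRing R] (I : Ideal R) (a b : ι → R)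
    (ha : ∀ i, a i ∈ I) (S : Finset ι) (m : ℕ) :
    (∏ i ∈ S, (C (a i) + X * C (b i))).coeff m ∈ I ^ (S.card - m) := by
  classical
  induction S using Finset.induction_on generalizing m with
  | empty => simp
  | insert i S hi ih =>
    rw [Finset.prod_insert hi, add_mul, coeff_add, coeff_C_mul, Finset.card_insert_of_notMem hi]
    refine add_mem ?_ ?_
    · have := Ideal.mul_mem_mul (ha i) (ih m)
      rw [← pow_succ'] at this
      exact Ideal.pow_le_pow_right (by omega) this
    · rw [mul_assoc]
      cases m with
      | zero => simp
      | succ m =>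
        rw [coeff_X_mul, coeff_C_mul, Nat.add_sub_add_right]
        exact Ideal.mul_mem_left _ _ (ih m)

/-- The pfaffian of a matrix that modulo `I` is an alternating matrix of rank two lies in
`I ^ (s - 1)`. -/
theorem pfaffian_mem_pow_of_rank_two {R : Type*} [CommRing R] {s : ℕ} (I : Ideal R)
    (A : Matrix (Fin (2 * s)) (Fin (2 * s)) R) (u v : Fin (2 * s) → R)
    (h : ∀ i j, i < j → A i j - (u i * v j - v i * u j) ∈ I) : pfaffian A ∈ I ^ (s - 1) := by
  let N : Matrix (Fin (2 * s)) (Fin (2 * s)) R :=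
    Matrix.of fun i j => if i < j then A i j - (u i * v j - v i * u j) else 0
  have hN (i j) : N i j ∈ I := by
    by_cases hij : i < j
    · simpa [N, hij] using h i j hij
    · simp [N, hij]
  have hA : pfaffian A = (pfaffian (pencil N u v)).eval 1 := by
    have := map_pfaffian (Polynomial.evalRingHom 1) (pencil N u v)
    rw [Polynomial.coe_evalRingHom] at this
    rw [this]
    refine pfaffian_congr fun i j hij => ?_
    simp [pencil, N, hij]
  -- Only the coefficients with m = 0, 1 remain, and they lie in I ^ (s - m).
  rw [hA, Polynomial.eval_eq_sum_range' (Nat.lt_succ_of_le (natDegree_pfaffian_pencil_le N u v))]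
  refine sum_mem fun m hm => ?_
  rw [one_pow, mul_one, pfaffian_def, Polynomial.finsetSum_coeff]
  refine sum_mem fun σ _ => ?_
  rw [← Polynomial.C_eq_intCast, Polynomial.coeff_C_mul]
  refine Ideal.mul_mem_left _ _ (Ideal.pow_le_pow_right ?_ (coeff_prod_C_add_X_mul_C_mem I
    (fun r => N (σ (pairFst r)) (σ (pairSnd r))) _ (fun r => hN _ _) Finset.univ m))
  have := Finset.mem_range.1 hm
  rw [Finset.card_univ, Fintype.card_fin]
  omega

/-! ### Pfaffians with many entries in an ideal, homogeneous entries, or a zero block -/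

theorem exists_pair_of_perm {s : ℕ} (σ : Perm (Fin (2 * s))) (a : Fin (2 * s)) :
    ∃ r, ∀ t, (σ (pairFst t) = a ∨ σ (pairSnd t) = a) ↔ t = r := by
  obtain ⟨⟨r, b⟩, h⟩ := (pairEquiv s).surjective (σ⁻¹ a)
  have ha : σ (pairEquiv s (r, b)) = a := by rw [h]; simp
  refine ⟨r, fun t => ⟨?_, ?_⟩⟩
  · rintro (h' | h')
    · exact (Prod.ext_iff.1 ((pairEquiv s).injective (σ.injective
        ((pairEquiv_false t ▸ h').trans ha.symm)))).1
    · exact (Prod.ext_iff.1 ((pairEquiv s).injective (σ.injective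
        ((pairEquiv_true t ▸ h').trans ha.symm)))).1
  · rintro rfl
    cases b
    · exact .inl ha
    · exact .inr ha

/-- In a matching at most |P| pairs meet P; each of the others contributes a factor in I. -/
theorem pfaffian_mem_pow_of_entries {R : Type*} [CommRing R] {s : ℕ} (I : Ideal R)
    (A : Matrix (Fin (2 * s)) (Fin (2 * s)) R) (P : Finset (Fin (2 * s)))
    (h : ∀ i j, i ∉ P → j ∉ P → A i j ∈ I) : pfaffian A ∈ I ^ (s - P.card) := by
  rw [pfaffian_def]
  refine sum_mem fun σ _ => Ideal.mul_mem_left _ _ ?_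
  choose c hc using exists_pair_of_perm σ
  let T := P.image c
  have hT : T.card ≤ P.card := Finset.card_image_le
  rw [← Finset.prod_mul_prod_compl T]
  refine Ideal.mul_mem_left _ _ (Ideal.pow_le_pow_right (n := Tᶜ.card) ?_ ?_)
  · rw [Finset.card_compl, Fintype.card_fin]
    omega
  · rw [← Finset.prod_const]
    refine Ideal.prod_mem_prod fun r hr => h _ _ ?_ ?_
    all_goals
      intro hP
      refine Finset.mem_compl.1 hr (Finset.mem_image.2 ⟨_, hP, ?_⟩)
      exact ((hc _ r).1 (by simp)).symm

theorem isHomogeneous_pfaffian {R τ : Type*} [CommRing R] {s : ℕ}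
    (A : Matrix (Fin (2 * s)) (Fin (2 * s)) (MvPolynomial τ R))
    (h : ∀ i j, (A i j).IsHomogeneous 1) : (pfaffian A).IsHomogeneous s := by
  rw [pfaffian_def]
  refine MvPolynomial.IsHomogeneous.sum _ _ _ fun σ _ => ?_
  have := MvPolynomial.IsHomogeneous.prod Finset.univ
    (fun r => A (σ (pairFst r)) (σ (pairSnd r))) (fun _ => 1) fun r _ => h _ _
  simpa using ((MvPolynomial.isHomogeneous_C τ ((Perm.sign σ : ℤ) : R)).mul this)

/-- Exactly one pair of each matching contains a, and it contributes degree 0. -/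
theorem isHomogeneous_pfaffian_of_border {R τ : Type*} [CommRing R] {s : ℕ}
    (A : Matrix (Fin (2 * s)) (Fin (2 * s)) (MvPolynomial τ R)) (a : Fin (2 * s))
    (h : ∀ i j, (A i j).IsHomogeneous (if i = a ∨ j = a then 0 else 1)) :
    (pfaffian A).IsHomogeneous (s - 1) := by
  rw [pfaffian_def]
  refine MvPolynomial.IsHomogeneous.sum _ _ _ fun σ _ => ?_
  have := MvPolynomial.IsHomogeneous.prod Finset.univ
    (fun r => A (σ (pairFst r)) (σ (pairSnd r))) _ fun r _ => h _ _
  obtain ⟨r, hr⟩ := exists_pair_of_perm σ a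
  simp only [hr] at this
  have hs : ∑ t : Fin s, (if t = r then 0 else 1) = s - 1 := by
    rw [← Finset.sum_erase_add _ _ (Finset.mem_univ r),
      Finset.sum_congr rfl fun t ht => if_neg (Finset.ne_of_mem_erase ht)]
    simp
  rw [hs] at this
  simpa using ((MvPolynomial.isHomogeneous_C τ ((Perm.sign σ : ℤ) : R)).mul this)

/-- The decomposition of `{0, …, 2 s - 1}` into its first and its second half. -/
def halvesEquiv (s : ℕ) : Fin s ⊕ Fin s ≃ Fin (2 * s) :=
  finSumFinEquiv.trans (finCongr (two_mul s).symm)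

/-- The decomposition of `{0, …, 2 s - 1}` into even and odd numbers. -/
def parityEquiv (s : ℕ) : Fin s ⊕ Fin s ≃ Fin (2 * s) :=
  (Equiv.boolProdEquivSum (Fin s)).symm.trans ((Equiv.prodComm _ _).trans (pairEquiv s))

@[simp] theorem halvesEquiv_inl {s : ℕ} (r : Fin s) : (halvesEquiv s (.inl r)).val = r := by
  simp [halvesEquiv]

@[simp] theorem halvesEquiv_inr {s : ℕ} (r : Fin s) : (halvesEquiv s (.inr r)).val = s + r := by
  simp [halvesEquiv, add_comm]

@[simp] theorem parityEquiv_inl {s : ℕ} (r : Fin s) : parityEquiv s (.inl r) = pairFst r := rfl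

@[simp] theorem parityEquiv_inr {s : ℕ} (r : Fin s) : parityEquiv s (.inr r) = pairSnd r := rfl

/-- The perfect matching of the first half of `{0, …, 2 s - 1}` with the second half
given by `τ`. -/
def halvesMatching {s : ℕ} (τ : Perm (Fin s)) : Perm (Fin (2 * s)) :=
  (parityEquiv s).symm.trans ((Equiv.sumCongr 1 τ).trans (halvesEquiv s))

@[simp] theorem halvesMatching_pairFst {s : ℕ} (τ : Perm (Fin s)) (r : Fin s) :
    halvesMatching τ (pairFst r) = halvesEquiv s (.inl r) := by
  simp [halvesMatching, ← parityEquiv_inl]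

@[simp] theorem halvesMatching_pairSnd {s : ℕ} (τ : Perm (Fin s)) (r : Fin s) :
    halvesMatching τ (pairSnd r) = halvesEquiv s (.inr (τ r)) := by
  simp [halvesMatching, ← parityEquiv_inr]

theorem sign_halvesMatching {s : ℕ} (τ : Perm (Fin s)) : Perm.sign (halvesMatching τ) =
    Perm.sign τ * Perm.sign ((parityEquiv s).symm.trans (halvesEquiv s)) := by
  have : Equiv.sumCongr 1 τ = Perm.sumCongr (1 : Perm (Fin s)) τ := rfl
  rw [halvesMatching, Perm.sign_trans_trans, this, Perm.sign_sumCongr]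
  simp

theorem isMatching_halvesMatching {s : ℕ} (τ : Perm (Fin s)) : IsMatching (halvesMatching τ) := by
  refine ⟨fun r => ?_, fun r t h => ?_⟩
  · rw [Fin.lt_def]
    simp
    omega
  · rw [Fin.lt_def]
    simpa using h

theorem perm_ext_pairs {s : ℕ} {σ σ' : Perm (Fin (2 * s))}
    (h1 : ∀ r, σ (pairFst r) = σ' (pairFst r)) (h2 : ∀ r, σ (pairSnd r) = σ' (pairSnd r)) :
    σ = σ' := by
  ext i
  obtain ⟨⟨r, b⟩, rfl⟩ := (pairEquiv s).surjective i
  cases b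
  · exact congrArg Fin.val (h1 r)
  · exact congrArg Fin.val (h2 r)

/-- The second elements fill the second half, so the first elements fill the first half; being
increasing, they are listed in their natural order. -/
theorem exists_eq_halvesMatching {s : ℕ} {σ : Perm (Fin (2 * s))} (hσ : IsMatching σ)
    (h : ∀ r, s ≤ (σ (pairSnd r)).val) : ∃ τ, halvesMatching τ = σ := by
  have hex (r : Fin s) : ∃ t : Fin s, σ (pairSnd r) = halvesEquiv s (.inr t) := by
    have := (σ (pairSnd r)).isLt
    refine ⟨⟨(σ (pairSnd r)).val - s, by omega⟩, Fin.ext ?_⟩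
    simp [h r]
  choose f hf using hex
  have hinj : Function.Injective f := fun a b hab => by
    refine pairSnd_injective (σ.injective ?_)
    rw [hf, hf, hab]
  let τ : Perm (Fin s) := Equiv.ofBijective f (Finite.injective_iff_bijective.1 hinj)
  have hlt (r : Fin s) : (σ (pairFst r)).val < s := by
    by_contra hr
    have := (σ (pairFst r)).isLt
    obtain ⟨t, ht⟩ := τ.surjective ⟨(σ (pairFst r)).val - s, by omega⟩
    refine pairFst_ne_pairSnd r t (σ.injective (Fin.ext ?_))
    rw [hf, halvesEquiv_inr, show f t = τ t from rfl, ht]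
    simp
    omega
  have hmono : StrictMono fun r => (⟨(σ (pairFst r)).val, hlt r⟩ : Fin s) := fun r t hrt =>
    hσ.2 r t hrt
  have hid (r : Fin s) : (σ (pairFst r)).val = r.val := by
    let g : Perm (Fin s) := Equiv.ofBijective _ (Finite.injective_iff_bijective.1 hmono.injective)
    have hg : g = 1 := (Equiv.Perm.monotone_iff g).1 hmono.monotone
    have := congrArg (fun g : Perm (Fin s) => (g r).val) hg
    exact this
  refine ⟨τ, perm_ext_pairs (fun r => Fin.ext ?_) fun r => ?_⟩
  · rw [halvesMatching_pairFst, halvesEquiv_inl, hid]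
  · rw [halvesMatching_pairSnd, hf]
    rfl

/-- A matching with a pair inside the first half contributes zero. The others join the two halves
bijectively, so the block of the second half plays no role and the Leibniz formula remains, up to
the sign of a fixed shuffle. -/
theorem pfaffian_eq_det_of_zero_block {R : Type*} [CommRing R] {s : ℕ}
    (A : Matrix (Fin (2 * s)) (Fin (2 * s)) R) (h : ∀ i j, i < j → j.val < s → A i j = 0) :
    pfaffian A = ((Perm.sign ((parityEquiv s).symm.trans (halvesEquiv s)) : ℤ) : R) *
      (Matrix.of fun r t => A (halvesEquiv s (.inl r)) (halvesEquiv s (.inr t))).det := by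
  rw [← Matrix.det_transpose, Matrix.det_apply', Finset.mul_sum, pfaffian_def]
  symm
  refine Finset.sum_of_injOn halvesMatching (fun τ _ τ' _ h => ?_) (fun τ _ => ?_)
    (fun σ hσ hσ' => ?_) fun τ _ => ?_
  · ext r
    have := congrArg (fun σ : Perm (Fin (2 * s)) => (σ (pairSnd r)).val) h
    simpa using this
  · simpa using isMatching_halvesMatching τ
  · have hm : IsMatching σ := (Finset.mem_filter.1 hσ).2
    have : ∃ r, (σ (pairSnd r)).val < s := by
      by_contra! hall
      obtain ⟨τ, rfl⟩ := exists_eq_halvesMatching hm hall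
      exact hσ' ⟨τ, by simp, rfl⟩
    obtain ⟨r, hr⟩ := this
    rw [Finset.prod_eq_zero (Finset.mem_univ r) (h _ _ (hm.1 r) hr), mul_zero]
  · rw [sign_halvesMatching]
    simp only [halvesMatching_pairFst, halvesMatching_pairSnd, Matrix.transpose_apply,
      Matrix.of_apply]
    push_cast
    ring

open Polynomial in
/-- A Cauchy matrix, possibly with one column of ones, is invertible. -/
theorem det_cauchy_ne_zero {k : Type*} [Field k] {s : ℕ} (a b : Fin s → k) (T : Finset (Fin s))
    (hT : T.card ≤ 1) (ha : Function.Injective a) (hb : ∀ t ∉ T, ∀ t' ∉ T, b t = b t' → t = t')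
    (hab : ∀ r, ∀ t ∉ T, b t ≠ a r) :
    (Matrix.of fun r t => if t ∈ T then 1 else (b t - a r)⁻¹).det ≠ 0 := by
  intro hdet
  obtain ⟨v, hv, h⟩ := Matrix.exists_mulVec_eq_zero_iff.2 hdet
  refine hv ?_
  -- For v in the kernel this is the numerator of the rational function ∑ v_t / (b_t - X), with the
  -- constant v_t for t ∈ T. It has degree less than s and vanishes at the s points a_r.
  let N : k[X] := ∑ t, C (v t) * ∏ l ∈ Tᶜ.erase t, (C (b l) - X)
  have hN : N = 0 := by
    refine eq_zero_of_natDegree_lt_card_of_eval_eq_zero N ha (fun r => ?_) ?_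
    · have h1 := congrArg (fun c => (∏ l ∈ Tᶜ, (b l - a r)) * c) (congrFun h r)
      simp only [Pi.zero_apply, mul_zero, Matrix.mulVec, dotProduct, Finset.mul_sum] at h1
      rw [← h1, eval_finsetSum]
      refine Finset.sum_congr rfl fun t _ => ?_
      simp only [eval_mul, eval_C, eval_prod, eval_sub, eval_X, Matrix.of_apply]
      by_cases ht : t ∈ T
      · rw [Finset.erase_eq_of_notMem (by simpa using ht), if_pos ht]
        ring
      · rw [← Finset.mul_prod_erase Tᶜ _ (Finset.mem_compl.2 ht), if_neg ht]
        have := sub_ne_zero.2 (hab r t ht)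
        field_simp
    · rw [Fintype.card_fin]
      rcases Nat.eq_zero_or_pos s with rfl | hs
      · exact absurd (Subsingleton.elim v 0) hv
      · refine Nat.lt_of_le_pred hs (natDegree_sum_le_of_forall_le _ _ fun t _ => ?_)
        refine (natDegree_C_mul_le _ _).trans ((natDegree_prod_le _ _).trans ?_)
        refine (Finset.sum_le_card_nsmul _ _ 1 fun l _ => ?_).trans ?_
        · exact (natDegree_sub_le _ _).trans (by simp)
        · have := Finset.card_le_card (Finset.erase_subset_erase t (Finset.subset_univ Tᶜ))
          rw [Finset.card_erase_of_mem (Finset.mem_univ t), Finset.card_univ, Fintype.card_fin] at this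
          simpa using this
  -- At b_t only the summand of t survives.
  have h0 (t : Fin s) (ht : t ∉ T) : v t = 0 := by
    have h1 := congrArg (eval (b t)) hN
    rw [eval_finsetSum, Finset.sum_eq_single t] at h1
    · simp only [eval_mul, eval_C, eval_prod, eval_sub, eval_X, eval_zero, mul_eq_zero] at h1
      refine h1.resolve_right (Finset.prod_ne_zero_iff.2 fun l hl => sub_ne_zero.2 fun e => ?_)
      rw [Finset.mem_erase, Finset.mem_compl] at hl
      exact hl.1 (hb l hl.2 t ht e)
    · intro t' _ htt
      rw [eval_mul, eval_prod, Finset.prod_eq_zero (i := t), mul_zero]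
      · simp [htt.symm, ht]
      · simp
    · simp
  funext t
  by_cases ht : t ∈ T
  -- Only the summand of the single t ∈ T is left; any a_r would do, as no b_l with l ∉ T equals it.
  · have h1 := congrArg (eval (a t)) hN
    rw [eval_finsetSum, Finset.sum_eq_single t] at h1
    · simp only [eval_mul, eval_C, eval_prod, eval_sub, eval_X, eval_zero, mul_eq_zero] at h1
      refine h1.resolve_right (Finset.prod_ne_zero_iff.2 fun l hl => sub_ne_zero.2 (hab t l ?_))
      exact Finset.mem_compl.1 (Finset.mem_of_mem_erase hl)
    · intro t' _ htt
      rw [h0 t' fun h' => htt (Finset.card_le_one.1 hT _ h' _ ht)]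
      simp
    · simp
  · exact h0 t ht

open MvPolynomial

/-! ### Points in general position -/

section

variable {k : Type*} [Field k] {n : ℕ} [NeZero n]

theorem lt_of_ne_lastIdx {i : Fin n} (hi : i ≠ lastIdx n) : i.val < n - 1 := by
  have h1 := i.isLt
  have h2 : i.val ≠ n - 1 := fun h => hi (Fin.ext h)
  omega

theorem extend_point {p : Fin (n - 2) → k} {i a : Fin n} (hi : i ≠ lastIdx n)
    (ha : a ≠ lastIdx n) (hai : a ≠ i) :
    extend (point p i) a = if i.val < n - 2 then 0 else 1 := by
  have h1 := lt_of_ne_lastIdx hi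
  have h2 := lt_of_ne_lastIdx ha
  have h3 : a.val ≠ i.val := fun h => hai (Fin.ext h)
  unfold extend point
  by_cases hin : i.val < n - 2
  · by_cases han : a.val < n - 2 <;> simp [hin, han, h3]
  · have h4 : i.val = n - 2 := by omega
    have han : a.val < n - 2 := by omega
    simp [h4, han]

theorem point_lastIdx (hn : 2 ≤ n) (p : Fin (n - 2) → k) : point p (lastIdx n) = p := by
  have h1 : ¬ n - 1 < n - 2 := by omega
  have h2 : ¬ n - 1 = n - 2 := by omega
  simp [point, lastIdx, h1, h2]

/-- If p_i = p_j, the nonzero linear form x_j - x_i (with x_{n-1} = 0) vanishes at the n - 2 points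
other than Q_i and Q_j, which span the space. -/
theorem extend_injOn_of_linearlyGeneral (hn : 2 ≤ n) {p : Fin (n - 2) → k}
    (hp : LinearlyGeneral (point (n := n) p)) {i j : Fin n} (hi : i ≠ lastIdx n)
    (hj : j ≠ lastIdx n) (hij : i < j) : extend p j - extend p i ≠ 0 := by
  intro h
  have hin : i.val < n - 2 := by
    have := lt_of_ne_lastIdx hj
    have : i.val < j.val := hij
    omega
  let φ : (Fin (n - 2) → k) →ₗ[k] k :=
    { toFun := fun v => extend v j - extend v i
      map_add' := fun v w => by unfold extend; split_ifs <;> simp <;> ring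
      map_smul' := fun c v => by unfold extend; split_ifs <;> simp <;> ring }
  let S : Finset (Fin n) := (Finset.univ.erase i).erase j
  have hS : S.card = n - 2 := by
    rw [Finset.card_erase_of_mem (by simp [hij.ne']), Finset.card_erase_of_mem (by simp)]
    simp
    omega
  have hφ : φ = 0 := by
    have hspan := (hp S hS).span_eq_top_of_card_eq_finrank' (by simp [hS])
    refine LinearMap.ext_on hspan ?_
    rintro _ ⟨⟨l, hl⟩, rfl⟩
    simp only [S, Finset.mem_erase, Finset.mem_univ, and_true] at hl
    change extend (point p l) j - extend (point p l) i = 0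
    by_cases hll : l = lastIdx n
    · rw [hll, point_lastIdx hn, h]
    · rw [extend_point hll hj hl.1.symm, extend_point hll hi hl.2.symm, sub_self]
  have := LinearMap.congr_fun hφ (Pi.single ⟨i.val, hin⟩ 1)
  change extend (Pi.single (⟨i.val, hin⟩ : Fin (n - 2)) (1 : k)) j -
    extend (Pi.single (⟨i.val, hin⟩ : Fin (n - 2)) (1 : k)) i = 0 at this
  have h3 : j.val ≠ i.val := fun h => hij.ne (Fin.ext h.symm)
  by_cases hjn : j.val < n - 2 <;> simp [extend, hin, hjn, h3] at this

end

/-! ### The entries of the matrix -/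

theorem sub_C_eval_mem_pointIdeal {k : Type*} [Field k] {r : ℕ} (q : Fin r → k)
    (f : MvPolynomial (Fin r) k) : f - C (eval q f) ∈ pointIdeal q := by
  induction f using MvPolynomial.induction_on with
  | C a => simp
  | add f g hf hg =>
    convert add_mem hf hg using 1
    simp only [map_add]
    ring
  | mul_X f i hf =>
    have h1 : X i - C (q i) ∈ pointIdeal q := Ideal.subset_span ⟨i, rfl⟩
    convert add_mem (Ideal.mul_mem_left _ f h1) (Ideal.mul_mem_left _ (C (q i)) hf) using 1
    simp only [map_mul, eval_X]
    ring

theorem mem_pointIdeal_of_eval_eq_zero {k : Type*} [Field k] {r : ℕ} {q : Fin r → k}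
    {f : MvPolynomial (Fin r) k} (h : eval q f = 0) : f ∈ pointIdeal q := by
  simpa [h] using sub_C_eval_mem_pointIdeal q f

theorem eval_extend_X {k : Type*} [Field k] {n : ℕ} (x : Fin (n - 2) → k) (i : Fin n) :
    eval x (extend X i) = extend x i := by
  unfold extend
  split_ifs <;> simp

theorem isHomogeneous_extend_X {k : Type*} [Field k] {n : ℕ} (i : Fin n) :
    (extend (X : Fin (n - 2) → MvPolynomial (Fin (n - 2)) k) i).IsHomogeneous 1 := by
  unfold extend
  split_ifs
  · exact isHomogeneous_X _ _
  · exact isHomogeneous_zero _ _ _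

section

variable {k : Type*} [Field k] {n : ℕ} [NeZero n]

theorem eval_skewMatrix (p x y : Fin (n - 2) → k) (i j : Fin n) :
    eval x (skewMatrix p y i j) = if i = j then 0 else if j = lastIdx n then 1
      else if i = lastIdx n then -1
      else (extend y j - extend y i) / (extend p j - extend p i) * (extend x j - extend x i) := by
  rw [skewMatrix, Matrix.of_apply]
  split_ifs <;> simp [eval_extend_X]

theorem eval_skewMatrix_comm (p x y : Fin (n - 2) → k) (i j : Fin n) :
    eval x (skewMatrix p y i j) = eval y (skewMatrix p x i j) := by
  rw [eval_skewMatrix, eval_skewMatrix, div_mul_eq_mul_div, div_mul_eq_mul_div, mul_comm]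

theorem eval_pfaffian_comm (p x y : Fin (n - 2) → k) {s : ℕ} (B : Finset (Fin n))
    (hB : B.card = 2 * s) : eval x (pfaffian (subMatrix (skewMatrix p y) B hB)) =
      eval y (pfaffian (subMatrix (skewMatrix p x) B hB)) := by
  rw [map_pfaffian, map_pfaffian]
  exact pfaffian_congr fun i j _ => eval_skewMatrix_comm p x y _ _

theorem isHomogeneous_skewMatrix (p y : Fin (n - 2) → k) (i j : Fin n) :
    (skewMatrix p y i j).IsHomogeneous (if i = lastIdx n ∨ j = lastIdx n then 0 else 1) := by
  rw [skewMatrix, Matrix.of_apply]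
  by_cases h : i = j
  · rw [if_pos h]
    exact isHomogeneous_zero _ _ _
  · by_cases hj : j = lastIdx n
    · rw [if_neg h, if_pos hj, if_pos (.inr hj)]
      exact isHomogeneous_one _ _
    · by_cases hi : i = lastIdx n
      · rw [if_neg h, if_neg hj, if_pos hi, if_pos (.inl hi)]
        exact (isHomogeneous_one _ _).neg
      · rw [if_neg h, if_neg hj, if_neg hi, if_neg (by tauto)]
        simpa using (isHomogeneous_C _ _).mul
          ((isHomogeneous_extend_X j).sub (isHomogeneous_extend_X i))

/-- At Q_i all extended coordinates with index other than i and n agree: they are 0 for i ≤ n - 2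
and 1 for i = n - 1. -/
theorem skewMatrix_mem_pointIdeal (p y : Fin (n - 2) → k) {i a b : Fin n} (hi : i ≠ lastIdx n)
    (ha : a ≠ lastIdx n) (hb : b ≠ lastIdx n) (hai : a ≠ i) (hbi : b ≠ i) :
    skewMatrix p y a b ∈ pointIdeal (point p i) := by
  refine mem_pointIdeal_of_eval_eq_zero ?_
  rw [eval_skewMatrix, if_neg hb, if_neg ha, extend_point hi ha hai, extend_point hi hb hbi]
  simp

/-! ### Degree and multiplicities of the pfaffians -/

theorem isHomogeneous_pfaffian_subMatrix (p y : Fin (n - 2) → k) {s : ℕ} (B : Finset (Fin n))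
    (hB : B.card = 2 * s) : (pfaffian (subMatrix (skewMatrix p y) B hB)).IsHomogeneous
      (if lastIdx n ∈ B then s - 1 else s) := by
  have h (i j) := isHomogeneous_skewMatrix p y (B.orderEmbOfFin hB i) (B.orderEmbOfFin hB j)
  by_cases hl : lastIdx n ∈ B
  · rw [if_pos hl]
    obtain ⟨a, ha⟩ : ∃ a, B.orderEmbOfFin hB a = lastIdx n := by
      have : lastIdx n ∈ Set.range (B.orderEmbOfFin hB) := by simpa using hl
      exact this
    refine isHomogeneous_pfaffian_of_border _ a fun i j => ?_
    have := h i j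
    simp only [← ha, (B.orderEmbOfFin hB).injective.eq_iff] at this
    exact this
  · rw [if_neg hl]
    refine isHomogeneous_pfaffian _ fun i j => ?_
    have hne (i) : B.orderEmbOfFin hB i ≠ lastIdx n := fun h =>
      hl (h ▸ B.orderEmbOfFin_mem hB i)
    have := h i j
    rwa [if_neg (by simp [hne])] at this

theorem pfaffian_subMatrix_mem_pow (p y : Fin (n - 2) → k) {s : ℕ} (B : Finset (Fin n))
    (hB : B.card = 2 * s) {i : Fin n} (hi : i ≠ lastIdx n) :
    pfaffian (subMatrix (skewMatrix p y) B hB) ∈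
      pointIdeal (point p i) ^ (s - (B ∩ {i, lastIdx n}).card) := by
  let P : Finset (Fin (2 * s)) := Finset.univ.filter fun a =>
    B.orderEmbOfFin hB a ∈ ({i, lastIdx n} : Finset (Fin n))
  have hP : P.card ≤ (B ∩ {i, lastIdx n}).card := by
    refine Finset.card_le_card_of_injOn (B.orderEmbOfFin hB) (fun a ha => ?_)
      (B.orderEmbOfFin hB).injective.injOn
    exact Finset.mem_coe.2 (Finset.mem_inter.2
      ⟨B.orderEmbOfFin_mem hB a, (Finset.mem_filter.1 ha).2⟩)
  refine Ideal.pow_le_pow_right (Nat.sub_le_sub_left hP s)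
    (pfaffian_mem_pow_of_entries _ _ P fun a b ha hb => ?_)
  simp only [P, Finset.mem_filter, Finset.mem_univ, true_and, Finset.mem_insert,
    Finset.mem_singleton, not_or] at ha hb
  exact skewMatrix_mem_pointIdeal p y hi ha.2 hb.2 ha.1 hb.1

/-- At x = p the denominators cancel and the entries become y_j - y_i, that is u_i v_j - v_i u_j
with u = 1 and v = y. Setting u_n = 0 and v_n = 1 accounts for the last column of ones. -/
theorem pfaffian_subMatrix_mem_pow_lastIdx (hn : 2 ≤ n) {p : Fin (n - 2) → k}
    (hp : LinearlyGeneral (point (n := n) p)) (y : Fin (n - 2) → k) {s : ℕ} (B : Finset (Fin n))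
    (hB : B.card = 2 * s) :
    pfaffian (subMatrix (skewMatrix p y) B hB) ∈ pointIdeal (point p (lastIdx n)) ^ (s - 1) := by
  rw [point_lastIdx hn]
  refine pfaffian_mem_pow_of_rank_two _ _
    (fun a => C (if B.orderEmbOfFin hB a = lastIdx n then 0 else 1))
    (fun a => C (if B.orderEmbOfFin hB a = lastIdx n then 1 else extend y (B.orderEmbOfFin hB a)))
    fun a b hab => mem_pointIdeal_of_eval_eq_zero ?_
  have hlt : B.orderEmbOfFin hB a < B.orderEmbOfFin hB b := (B.orderEmbOfFin hB).strictMono hab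
  change eval p (skewMatrix p y (B.orderEmbOfFin hB a) (B.orderEmbOfFin hB b) - _) = 0
  generalize B.orderEmbOfFin hB a = i at *
  generalize B.orderEmbOfFin hB b = j at *
  have hi : i ≠ lastIdx n := by
    rintro rfl
    have h1 : n - 1 < j.val := hlt
    omega
  rw [map_sub, eval_skewMatrix, if_neg hlt.ne]
  by_cases hj : j = lastIdx n
  · simp [hi, hj]
  · have := extend_injOn_of_linearlyGeneral hn hp hi hj hlt
    simp [hi, hj]
    field_simp
    ring

/-- In both cases of D(B) the required multiplicity is s - |B ∩ {i, n}| at Q_i for i < n, and s - 1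
at Q_n, negative values imposing no condition. -/
theorem pfaffian_subMatrix_mem_sections (hn : 2 ≤ n) {p : Fin (n - 2) → k}
    (hp : LinearlyGeneral (point (n := n) p)) (y : Fin (n - 2) → k) {s : ℕ} (B : Finset (Fin n))
    (hB : B.card = 2 * s) :
    pfaffian (subMatrix (skewMatrix p y) B hB) ∈ sections p (divisorOf B s) := by
  have hdeg := isHomogeneous_pfaffian_subMatrix p y B hB
  have hlast := pfaffian_subMatrix_mem_pow_lastIdx hn hp y B hB
  have hmult (i : Fin n) (hi : i ≠ lastIdx n) := pfaffian_subMatrix_mem_pow p y B hB hi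
  have hcard (i : Fin n) (hi : i ≠ lastIdx n) : (B ∩ {i, lastIdx n}).card =
      (if i ∈ B then 1 else 0) + if lastIdx n ∈ B then 1 else 0 := by
    by_cases h1 : i ∈ B <;> by_cases h2 : lastIdx n ∈ B <;>
      simp [Finset.inter_insert_of_mem, Finset.inter_insert_of_notMem, h1, h2, hi]
  rw [divisorOf_eq]
  by_cases hl : lastIdx n ∈ B
  · have hs : 0 < s := by
      have := Finset.card_pos.2 ⟨_, hl⟩
      omega
    rw [if_pos hl] at hdeg ⊢
    refine Submodule.mem_inf.2 ⟨?_, Submodule.mem_iInf _ |>.2 fun i => ?_⟩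
    · have h0 : (0 : ℤ) ≤ (s : ℤ) - 1 := by omega
      have h1 : ((s : ℤ) - 1).toNat = s - 1 := by omega
      rw [oddClass, if_pos h0]
      simp only [h1]
      exact hdeg
    · rw [Submodule.restrictScalars_mem]
      by_cases hi : i = lastIdx n
      · subst hi
        exact Ideal.pow_le_pow_right (by simp [oddClass]) hlast
      · refine Ideal.pow_le_pow_right ?_ (hmult i hi)
        rw [hcard i hi]
        by_cases hiB : i ∈ B <;> simp [oddClass, hiB, hl, hi] <;> omega
  · rw [if_neg hl] at hdeg ⊢
    refine Submodule.mem_inf.2 ⟨?_, Submodule.mem_iInf _ |>.2 fun i => ?_⟩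
    · rw [oddClass, if_pos (Int.natCast_nonneg s)]
      exact hdeg
    · rw [Submodule.restrictScalars_mem]
      by_cases hi : i = lastIdx n
      · subst hi
        refine Ideal.pow_le_pow_right ?_ hlast
        simp [oddClass]
        omega
      · refine Ideal.pow_le_pow_right ?_ (hmult i hi)
        rw [hcard i hi]
        by_cases hiB : i ∈ B <;> simp [oddClass, hiB, hl, hi] <;> omega

/-! ### The pfaffians do not vanish -/

theorem exists_eval_pfaffian_ne_zero (hn : 2 ≤ n) {p : Fin (n - 2) → k}
    (hp : LinearlyGeneral (point (n := n) p)) {s : ℕ} (B : Finset (Fin n)) (hB : B.card = 2 * s) :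
    ∃ x : Fin (n - 2) → k, eval x (pfaffian (subMatrix (skewMatrix p x) B hB)) ≠ 0 := by
  classical
  let e := B.orderEmbOfFin hB
  have he {a b : Fin (2 * s)} (h : a < b) : (e a).val < (e b).val := e.strictMono h
  -- With y = x the entries are (x_j - x_i)² / (p_j - p_i): zero within the first half of B, and 1 /
  -- (p_j - p_i) between the halves when j ≠ n.
  let x : Fin (n - 2) → k := fun l => if ∃ a, a.val < s ∧ (e a).val = l.val then 1 else 0
  have hx1 (a : Fin (2 * s)) (ha : a.val < s) (hn : (e a).val < n - 2) : extend x (e a) = 1 := by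
    simp only [extend, hn, x, dif_pos]
    exact if_pos ⟨a, ha, rfl⟩
  have hx0 (a : Fin (2 * s)) (ha : s ≤ a.val) : extend x (e a) = 0 := by
    unfold extend
    split_ifs with h
    · refine if_neg ?_
      rintro ⟨b, hb, hab⟩
      have := e.injective (Fin.ext hab)
      subst this
      omega
    · rfl
  have hlt (a b : Fin (2 * s)) (hab : a < b) : e a ≠ lastIdx n := by
    intro h
    have h1 := he hab
    have h2 : (e a).val = n - 1 := by rw [h]; rfl
    omega
  refine ⟨x, ?_⟩
  rw [map_pfaffian, pfaffian_eq_det_of_zero_block]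
  · refine mul_ne_zero ?_ ?_
    · rcases Int.units_eq_one_or (Equiv.Perm.sign ((parityEquiv s).symm.trans (halvesEquiv s)))
        with h | h <;> simp [h]
    · let T : Finset (Fin s) := Finset.univ.filter fun t => e (halvesEquiv s (.inr t)) = lastIdx n
      have hhalf (r t : Fin s) : halvesEquiv s (.inl r) < halvesEquiv s (.inr t) := by
        rw [Fin.lt_def]
        simp
        omega
      have hinj {a b : Fin (2 * s)} (ha : e a ≠ lastIdx n) (hb : e b ≠ lastIdx n)
          (h : extend p (e a) = extend p (e b)) : a = b := by
        rcases lt_trichotomy a b with hab | hab | hab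
        · exact absurd (sub_eq_zero.2 h.symm)
            (extend_injOn_of_linearlyGeneral hn hp ha hb (e.strictMono hab))
        · exact hab
        · exact absurd (sub_eq_zero.2 h)
            (extend_injOn_of_linearlyGeneral hn hp hb ha (e.strictMono hab))
      have hl (r : Fin s) := hlt _ _ (hhalf r r)
      have hT (t : Fin s) : t ∉ T ↔ e (halvesEquiv s (.inr t)) ≠ lastIdx n := by simp [T]
      convert det_cauchy_ne_zero (fun r => extend p (e (halvesEquiv s (.inl r))))
        (fun t => extend p (e (halvesEquiv s (.inr t)))) T ?_ ?_ ?_ ?_ using 4 with r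
      · funext t
        change eval x (skewMatrix p x (e _) (e _)) = _
        rw [eval_skewMatrix, if_neg (fun h => (hhalf r t).ne (e.injective h)), if_neg (hl r)]
        by_cases h : e (halvesEquiv s (.inr t)) = lastIdx n
        · rw [if_pos h, if_pos (by simpa [T] using h)]
        · rw [if_neg h, if_neg ((hT t).2 h), hx0 _ (by simp), hx1 _ (by simp)]
          · rw [div_mul_eq_mul_div, inv_eq_one_div]
            ring
          · have h1 := lt_of_ne_lastIdx h
            have h2 := he (hhalf r t)
            omega
      · refine Finset.card_le_one.2 fun t ht t' ht' => ?_
        have := e.injective ((Finset.mem_filter.1 ht).2.trans (Finset.mem_filter.1 ht').2.symm)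
        simpa using this
      · intro r r' h
        simpa using hinj (hl r) (hl r') h
      · intro t ht t' ht' h
        simpa using hinj ((hT t).1 ht) ((hT t').1 ht') h
      · intro r t ht h
        exact (hhalf r t).ne' (hinj ((hT t).1 ht) (hl r) h)
  · intro a b hab hb
    change eval x (skewMatrix p x (e a) (e b)) = 0
    have h0 : a.val < b.val := hab
    have h1 := he hab
    -- Two indices in the first half force s ≥ 2, so B has at least two elements above `e b`. Hence
    -- `e a` and `e b` avoid the last two indices, where `extend x` is 0 and not 1.
    have h2 : (e b).val < (e ⟨s, by omega⟩).val := he hb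
    have h3 : (e ⟨s, by omega⟩).val < (e ⟨s + 1, by omega⟩).val := he (Nat.lt_succ_self s)
    have h4 := (e ⟨s + 1, by omega⟩).isLt
    rw [eval_skewMatrix, if_neg (fun h => hab.ne (e.injective h)), if_neg (hlt b ⟨s, by omega⟩ hb),
      if_neg (hlt a b hab), hx1 a (by omega) (by omega), hx1 b hb (by omega)]
    simp

end

end BlowUp

/-! ### Nonvanishing at generic y from the symmetry in x and y -/

theorem mainTheorem3 {k : Type*} [Field k] [IsAlgClosed k] {n : ℕ} [NeZero n] (hn : 5 ≤ n)
    (p : Fin (n - 2) → k) (hp : BlowUp.LinearlyGeneral (BlowUp.point (n := n) p))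
    (y : Fin (n - 2) → k)
    (hy : ∀ D : BlowUp.Pic n, BlowUp.IsMinusOneDivisor D →
      ∀ f ∈ BlowUp.sections p D, f ≠ 0 → MvPolynomial.eval y f ≠ 0)
    (B : Finset (Fin n)) (s : ℕ) (hB : B.card = 2 * s) :
    BlowUp.pfaffian (BlowUp.subMatrix (BlowUp.skewMatrix p y) B hB) ≠ 0 ∧
      BlowUp.pfaffian (BlowUp.subMatrix (BlowUp.skewMatrix p y) B hB) ∈
        BlowUp.sections p (BlowUp.divisorOf B s) ∧
      (BlowUp.pfaffian (BlowUp.subMatrix (BlowUp.skewMatrix p y) B hB)).IsHomogeneous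
        (if BlowUp.lastIdx n ∈ B then s - 1 else s) ∧
      BlowUp.pfaffian (BlowUp.subMatrix (BlowUp.skewMatrix p y) B hB) ∈
        BlowUp.pointIdeal (BlowUp.point p (BlowUp.lastIdx n)) ^ (s - 1) := by
  have hn2 : 2 ≤ n := by omega
  refine ⟨?_, BlowUp.pfaffian_subMatrix_mem_sections hn2 hp y B hB,
    BlowUp.isHomogeneous_pfaffian_subMatrix p y B hB,
    BlowUp.pfaffian_subMatrix_mem_pow_lastIdx hn2 hp y B hB⟩
  obtain ⟨x, hx⟩ := BlowUp.exists_eval_pfaffian_ne_zero hn2 hp B hB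
  -- The hypothesis on y is applied to the section built from x instead of y; the symmetry then
  -- exchanges the two points.
  have h := hy _ (BlowUp.isMinusOneDivisor_divisorOf hn2 B s hB) _
    (BlowUp.pfaffian_subMatrix_mem_sections hn2 hp x B hB)
    (fun h => hx (by rw [h, map_zero]))
  rw [BlowUp.eval_pfaffian_comm] at h
  exact fun h0 => h (by rw [h0, map_zero])
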